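/- **Prime Number Theorem (Chebyshev form).** Let $\Lambda$ be the von Mangoldt function on the positive integers, that is, $\Lambda(n)=\log p$ if $n=p^k$ for a prime $p$ and an integer $k\ge 1$, and $\Lambda(n)=0$ otherwise. For real $x$ put $$\psi(x)=\sum_{1\le n<x}\Lambda(n).$$ Then $\psi(x)\sim x$ as $x\to+\infty$ (through the real numbers), that is, $\lim_{x\to+\infty}\psi(x)/x=1$. -/

import Mathlib

/-- The Chebyshev function with strict summation condition: the sum of the von Mangoldt function
`Λ(n)` over the positive integers `n < x`. -/
noncomputable def chebyshevPsi (x : ℝ) : ℝ :=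
  ∑ n ∈ Finset.Ico 1 ⌈x⌉₊, ArithmeticFunction.vonMangoldt n

/-- The index set in `chebyshevPsi x` is exactly the set of positive integers `n < x`. -/
theorem mem_Ico_one_ceil_iff (x : ℝ) (n : ℕ) :
    n ∈ Finset.Ico 1 ⌈x⌉₊ ↔ 1 ≤ n ∧ (n : ℝ) < x := by
  rw [Finset.mem_Ico, Nat.lt_ceil]

/-!
The proof is the Fourier-analytic one of Wiener and Ikehara. Put `B u = ψ(exp u) * exp (-u)`
(`chebyshevRatio`); the claim is `B u → 1`. Chebyshev's bound says that `B` is bounded, and partial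
summation expresses `L(Λ, s) = -ζ'(s) / ζ(s)` as `s` times the Laplace transform of `B` at `s - 1`.
Since `ζ` does not vanish on the line `Re s = 1`, removing the pole at `s = 1` shows that the
Laplace transform of `B - 1` extends continuously to the imaginary axis.

The Fejér kernel `K` is nonnegative, integrable, and the Fourier transform of a function supported
on `[-1, 1]` (`fejerKernel_eq_integral`). Averaging `B - 1` against a rescaled kernel `K (l (y - u))`
therefore involves only a compact segment of the imaginary axis, and the Riemann-Lebesgue
lemma shows that the average tends to `0` as `y → ∞` (`tendsto_integral_mul_fejerKernel`). So the
averages of `B` near `y`, at every scale `1 / l`, tend to `1`. As `exp u * B u = ψ(exp u)` is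
increasing, `B` changes little downwards on a short interval, and a value of `B` away from `1`
would spoil an average at a fine enough scale (`tendsto_one_of_tendsto_integral_comp_sub_mul`).
-/

section

open Filter Topology MeasureTheory Set

/-! ### The Fejér kernel -/

/-- The Fejér kernel on the real line, normalised so that it is the Fourier transform of the
triangle function `max (1 - |t|) 0`. `Real.sinc` is used so that the value at `0` is `1`. -/
noncomputable def fejerKernel (v : ℝ) : ℝ := Real.sinc (v / 2) ^ 2

lemma fejerKernel_nonneg (v : ℝ) : 0 ≤ fejerKernel v := sq_nonneg _

lemma continuous_fejerKernel : Continuous fejerKernel :=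
  (Real.continuous_sinc.comp (continuous_id.div_const 2)).pow 2

lemma fejerKernel_of_ne_zero {v : ℝ} (hv : v ≠ 0) :
    fejerKernel v = 2 * (1 - Real.cos v) / v ^ 2 := by
  rw [fejerKernel, Real.sinc_of_ne_zero (by positivity), div_pow, Real.sin_sq_eq_half_sub,
    mul_div_cancel₀ v two_ne_zero]
  field_simp

lemma fejerKernel_le (v : ℝ) : fejerKernel v ≤ 5 * (1 + v ^ 2)⁻¹ := by
  have h1 : fejerKernel v ≤ 1 := by
    rw [fejerKernel, ← sq_abs]
    exact pow_le_one₀ (abs_nonneg _) (Real.abs_sinc_le_one _)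
  have h2 : fejerKernel v * v ^ 2 ≤ 4 := by
    rcases eq_or_ne v 0 with rfl | hv
    · simp
    · rw [fejerKernel_of_ne_zero hv, div_mul_cancel₀ _ (by positivity)]
      linarith [Real.neg_one_le_cos v]
  rw [← div_eq_mul_inv, le_div_iff₀ (by positivity)]
  linarith

lemma integrable_fejerKernel : Integrable fejerKernel := by
  refine (integrable_inv_one_add_sq.const_mul 5).mono'
    continuous_fejerKernel.aestronglyMeasurable (ae_of_all _ fun v ↦ ?_)
  rw [Real.norm_of_nonneg (fejerKernel_nonneg v)]
  exact fejerKernel_le v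

lemma integral_fejerKernel_pos : 0 < ∫ v, fejerKernel v := by
  rw [integral_pos_iff_support_of_nonneg fejerKernel_nonneg integrable_fejerKernel]
  exact continuous_fejerKernel.isOpen_support.measure_pos volume ⟨0, by simp [fejerKernel]⟩

/-- The Fejér kernel only involves frequencies in `[-1, 1]`. This compact support is what allows
a Laplace transform to be moved to the boundary of its half-plane of convergence. -/
lemma fejerKernel_eq_integral (v : ℝ) :
    (fejerKernel v : ℂ) =
      ∫ t in (-1 : ℝ)..1, ((1 - |t| : ℝ) : ℂ) * Complex.exp (t * v * Complex.I) := by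
  have hint : ∀ a b : ℝ, IntervalIntegrable
      (fun t : ℝ ↦ ((1 - |t| : ℝ) : ℂ) * Complex.exp (t * v * Complex.I)) volume a b :=
    fun a b ↦ Continuous.intervalIntegrable (by fun_prop) a b
  -- folding the integral onto `[0, 1]` removes the absolute value
  have hfold : ∫ t in (-1 : ℝ)..1, ((1 - |t| : ℝ) : ℂ) * Complex.exp (t * v * Complex.I) =
      ((∫ t in (0 : ℝ)..1, 2 * ((1 - t) * Real.cos (t * v)) : ℝ) : ℂ) := by
    rw [← intervalIntegral.integral_add_adjacent_intervals (hint (-1) 0) (hint 0 1)]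
    have h := intervalIntegral.integral_comp_neg (a := 0) (b := 1)
      (fun t : ℝ ↦ ((1 - |t| : ℝ) : ℂ) * Complex.exp (t * v * Complex.I))
    rw [neg_zero] at h
    have hneg : IntervalIntegrable (fun t : ℝ ↦
        ((1 - |-t| : ℝ) : ℂ) * Complex.exp (((-t : ℝ) : ℂ) * v * Complex.I)) volume 0 1 :=
      Continuous.intervalIntegrable (by fun_prop) _ _
    rw [← h, ← intervalIntegral.integral_add hneg (hint 0 1), ← intervalIntegral.integral_ofReal]
    refine intervalIntegral.integral_congr fun t ht ↦ ?_
    rw [uIcc_of_le zero_le_one] at ht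
    simp only [abs_neg, abs_of_nonneg ht.1]
    push_cast
    rw [Complex.cos, neg_mul, neg_mul]
    ring
  rw [hfold]
  congr 1
  rcases eq_or_ne v 0 with rfl | hv
  · have : ∫ t in (0 : ℝ)..1, 2 * ((1 - t) * Real.cos (t * 0)) = 1 := by
      simp only [mul_zero, Real.cos_zero, mul_one]
      rw [intervalIntegral.integral_const_mul, intervalIntegral.integral_sub (by simp) (by simp)]
      norm_num
    rw [this]
    simp [fejerKernel]
  · rw [fejerKernel_of_ne_zero hv]
    -- the antiderivative comes from one integration by parts
    have hderiv : ∀ t ∈ uIcc (0 : ℝ) 1, HasDerivAt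
        (fun t : ℝ ↦ 2 * ((1 - t) * Real.sin (t * v) / v - Real.cos (t * v) / v ^ 2))
        (2 * ((1 - t) * Real.cos (t * v))) t := by
      intro t _
      have hm : HasDerivAt (fun t : ℝ ↦ t * v) v t := by simpa using (hasDerivAt_id t).mul_const v
      have := ((((hasDerivAt_id t).const_sub 1).mul hm.sin).div_const v).sub
        (hm.cos.div_const (v ^ 2)) |>.const_mul 2
      convert! this using 1
      simp
      field_simp
      ring
    rw [intervalIntegral.integral_eq_sub_of_hasDerivAt hderiv
      (Continuous.intervalIntegrable (by fun_prop) _ _)]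
    simp
    field_simp
    ring

/-! ### Averages against the Fejér kernel -/

/-- Averaging `β u * exp (-σ u)` against a rescaled Fejér kernel only sees the Laplace transform
of `β` on a compact segment of the line `Re s = σ`. This is Fubini's theorem. -/
lemma integral_mul_exp_mul_fejerKernel {β : ℝ → ℝ} (hβ : Measurable β) {C : ℝ}
    (hC : ∀ u, |β u| ≤ C) {σ : ℝ} (hσ : 0 < σ) (l y : ℝ) :
    ((∫ u in Ioi (0 : ℝ), β u * Real.exp (-σ * u) * fejerKernel (l * (y - u)) : ℝ) : ℂ) =
      ∫ t in (-1 : ℝ)..1, ((1 - |t| : ℝ) : ℂ) * Complex.exp (t * (l * y) * Complex.I) *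
        ∫ u in Ioi (0 : ℝ), (β u : ℂ) * Complex.exp (-(σ + (l * t : ℝ) * Complex.I) * u) := by
  have hf : IntegrableOn (fun u ↦ (β u : ℂ) * (Real.exp (-σ * u) : ℝ)) (Ioi 0) := by
    refine ((integrableOn_exp_mul_Ioi (neg_lt_zero.mpr hσ) 0).const_mul C).mono' ?_ ?_
    · exact Measurable.aestronglyMeasurable (by fun_prop)
    · refine ae_of_all _ fun u ↦ ?_
      rw [norm_mul, Complex.norm_real, Complex.norm_real, Real.norm_of_nonneg (Real.exp_pos _).le]
      exact mul_le_mul_of_nonneg_right (hC u) (Real.exp_pos _).le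
  have hg : IntegrableOn (fun t : ℝ ↦ ((1 - |t| : ℝ) : ℂ)) (Ioc (-1) 1) :=
    (Continuous.intervalIntegrable (by fun_prop) (-1) 1).1
  have hfg : Integrable (fun p : ℝ × ℝ ↦ (β p.1 : ℂ) * (Real.exp (-σ * p.1) : ℝ) *
      ((1 - |p.2| : ℝ) : ℂ) * Complex.exp ((p.2 * (l * (y - p.1)) : ℝ) * Complex.I))
      ((volume.restrict (Ioi 0)).prod (volume.restrict (Ioc (-1) 1))) := by
    refine (hf.mul_prod hg).mul_bdd (c := 1)
      (Continuous.aestronglyMeasurable (by fun_prop)) (ae_of_all _ fun p ↦ ?_)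
    rw [Complex.norm_exp_ofReal_mul_I]
  calc
    _ = ∫ u in Ioi (0 : ℝ), ∫ t in Ioc (-1 : ℝ) 1, (β u : ℂ) * (Real.exp (-σ * u) : ℝ) *
          ((1 - |t| : ℝ) : ℂ) * Complex.exp ((t * (l * (y - u)) : ℝ) * Complex.I) := by
      rw [← integral_complex_ofReal]
      refine integral_congr_ae (ae_of_all _ fun u ↦ ?_)
      dsimp only
      simp_rw [mul_assoc ((β u : ℂ) * _)]
      rw [integral_const_mul, Complex.ofReal_mul, fejerKernel_eq_integral,
        intervalIntegral.integral_of_le (by norm_num), Complex.ofReal_mul]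
      simp only [Complex.ofReal_mul]
    _ = ∫ t in Ioc (-1 : ℝ) 1, ∫ u in Ioi (0 : ℝ), (β u : ℂ) * (Real.exp (-σ * u) : ℝ) *
          ((1 - |t| : ℝ) : ℂ) * Complex.exp ((t * (l * (y - u)) : ℝ) * Complex.I) :=
      integral_integral_swap hfg
    _ = _ := by
      rw [intervalIntegral.integral_of_le (by norm_num)]
      refine integral_congr_ae (ae_of_all _ fun t ↦ ?_)
      dsimp only
      rw [← integral_const_mul]
      refine integral_congr_ae (ae_of_all _ fun u ↦ ?_)
      dsimp only
      rw [Complex.ofReal_exp]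
      have : Complex.exp (t * (l * y) * Complex.I) *
          Complex.exp (-(σ + (l * t : ℝ) * Complex.I) * u) =
          Complex.exp ((-σ * u : ℝ)) * Complex.exp ((t * (l * (y - u)) : ℝ) * Complex.I) := by
        rw [← Complex.exp_add, ← Complex.exp_add]
        congr 1
        push_cast
        ring
      linear_combination (-(1 - |t| : ℝ) * β u : ℂ) * this

/-- The boundary case of `integral_mul_exp_mul_fejerKernel`: if the Laplace transform of a bounded
function extends continuously to the imaginary axis, the damping factor `exp (-σ u)` may be
dropped. Both sides of the identity converge as `σ → 0`, the left one because `β` is bounded and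
the kernel is integrable. -/
lemma integral_mul_fejerKernel {β : ℝ → ℝ} (hβ : Measurable β) {C : ℝ}
    (hC : ∀ u, |β u| ≤ C) {H : ℂ → ℂ} (hH : ContinuousOn H {s | 0 ≤ s.re})
    (hβH : ∀ s : ℂ, 0 < s.re → ∫ u in Ioi (0 : ℝ), (β u : ℂ) * Complex.exp (-s * u) = H s)
    {l : ℝ} (hl : 0 < l) (y : ℝ) :
    ((∫ u in Ioi (0 : ℝ), β u * fejerKernel (l * (y - u)) : ℝ) : ℂ) =
      ∫ t in (-1 : ℝ)..1, ((1 - |t| : ℝ) : ℂ) * Complex.exp (t * (l * y) * Complex.I) *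
        H ((l * t : ℝ) * Complex.I) := by
  have hK : Integrable fun u ↦ fejerKernel (l * (y - u)) :=
    (integrable_fejerKernel.comp_mul_left' hl.ne').comp_sub_left y
  -- `H` precomposed with the projection to the closed half-plane is continuous everywhere
  have hcont : Continuous fun p : ℝ × ℝ ↦ H ((max p.1 0 : ℝ) + (l * p.2 : ℝ) * Complex.I) := by
    refine hH.comp_continuous (by fun_prop) fun p ↦ ?_
    simp
  have hright : Tendsto (fun σ : ℝ ↦ ∫ t in (-1 : ℝ)..1, ((1 - |t| : ℝ) : ℂ) *
      Complex.exp (t * (l * y) * Complex.I) * H ((max σ 0 : ℝ) + (l * t : ℝ) * Complex.I))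
      (𝓝[>] 0) (𝓝 (∫ t in (-1 : ℝ)..1, ((1 - |t| : ℝ) : ℂ) *
      Complex.exp (t * (l * y) * Complex.I) * H ((l * t : ℝ) * Complex.I))) := by
    have := (intervalIntegral.continuous_parametric_intervalIntegral_of_continuous'
      (μ := volume) (f := fun σ t : ℝ ↦ ((1 - |t| : ℝ) : ℂ) *
      Complex.exp (t * (l * y) * Complex.I) * H ((max σ 0 : ℝ) + (l * t : ℝ) * Complex.I))
      (Continuous.mul (by fun_prop) hcont) (-1) 1).tendsto 0
    simp only [max_self, Complex.ofReal_zero, zero_add] at this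
    exact this.mono_left nhdsWithin_le_nhds
  have hleft : Tendsto (fun σ : ℝ ↦
      ∫ u in Ioi (0 : ℝ), β u * Real.exp (-σ * u) * fejerKernel (l * (y - u)))
      (𝓝[>] 0) (𝓝 (∫ u in Ioi (0 : ℝ), β u * fejerKernel (l * (y - u)))) := by
    refine tendsto_integral_filter_of_dominated_convergence
      (fun u ↦ C * fejerKernel (l * (y - u))) ?_ ?_ (hK.const_mul C).integrableOn ?_
    · refine Eventually.of_forall fun σ ↦ ?_
      have := continuous_fejerKernel.measurable
      exact Measurable.aestronglyMeasurable (by fun_prop)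
    · filter_upwards [self_mem_nhdsWithin] with σ hσ
      filter_upwards [ae_restrict_mem measurableSet_Ioi] with u hu
      rw [norm_mul, norm_mul, Real.norm_of_nonneg (fejerKernel_nonneg _),
        Real.norm_of_nonneg (Real.exp_pos _).le]
      refine mul_le_mul_of_nonneg_right ?_ (fejerKernel_nonneg _)
      have h1 : Real.exp (-σ * u) ≤ 1 := by
        rw [Real.exp_le_one_iff, neg_mul, neg_nonpos]
        exact mul_nonneg (le_of_lt hσ) (le_of_lt hu)
      exact (mul_le_of_le_one_right (abs_nonneg _) h1).trans (hC u)
    · refine ae_of_all _ fun u ↦ Tendsto.mul_const _ ?_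
      have : Continuous fun σ : ℝ ↦ β u * Real.exp (-σ * u) := by fun_prop
      simpa using (this.tendsto 0).mono_left nhdsWithin_le_nhds
  refine tendsto_nhds_unique ((Complex.continuous_ofReal.tendsto _).comp hleft)
    (hright.congr' ?_)
  filter_upwards [self_mem_nhdsWithin] with σ hσ
  rw [mem_Ioi] at hσ
  rw [Function.comp_apply, integral_mul_exp_mul_fejerKernel hβ hC hσ]
  refine intervalIntegral.integral_congr fun t _ ↦ ?_
  rw [hβH _ (by simpa using hσ), max_eq_left hσ.le]

/-- By the Riemann-Lebesgue lemma, the averages of `β` against translated Fejér kernels tend to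
zero as soon as the Laplace transform of `β` is continuous up to the imaginary axis. -/
lemma tendsto_integral_mul_fejerKernel {β : ℝ → ℝ} (hβ : Measurable β) {C : ℝ}
    (hC : ∀ u, |β u| ≤ C) {H : ℂ → ℂ} (hH : ContinuousOn H {s | 0 ≤ s.re})
    (hβH : ∀ s : ℂ, 0 < s.re → ∫ u in Ioi (0 : ℝ), (β u : ℂ) * Complex.exp (-s * u) = H s)
    {l : ℝ} (hl : 0 < l) :
    Tendsto (fun y ↦ ∫ u in Ioi (0 : ℝ), β u * fejerKernel (l * (y - u))) atTop (𝓝 0) := by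
  have hRL := Real.tendsto_integral_exp_smul_cocompact ((Ioc (-1 : ℝ) 1).indicator
    fun t : ℝ ↦ ((1 - |t| : ℝ) : ℂ) * H ((l * t : ℝ) * Complex.I))
  -- `Real.fourierChar` carries the factor `2 * π`, and the sign of the frequency is reversed
  have hfreq : Tendsto (fun y : ℝ ↦ y * (-l / (2 * Real.pi))) atTop (cocompact ℝ) :=
    (tendsto_id.atTop_mul_const_of_neg
      (div_neg_of_neg_of_pos (neg_lt_zero.mpr hl) (by positivity))).mono_right
      atBot_le_cocompact
  have h := hRL.comp hfreq
  rw [← Complex.ofReal_zero] at h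
  suffices Tendsto (fun y ↦
      ((∫ u in Ioi (0 : ℝ), β u * fejerKernel (l * (y - u)) : ℝ) : ℂ)) atTop (𝓝 ((0 : ℝ) : ℂ)) by
    exact (Complex.continuous_re.tendsto _).comp this
  refine h.congr fun y ↦ ?_
  rw [integral_mul_fejerKernel hβ hC hH hβH hl, intervalIntegral.integral_of_le (by norm_num),
    ← integral_indicator measurableSet_Ioc, Function.comp_apply]
  refine integral_congr_ae (ae_of_all _ fun t ↦ ?_)
  by_cases ht : t ∈ Ioc (-1 : ℝ) 1
  · simp only [indicator_of_mem ht, Circle.smul_def, Real.fourierChar_apply, smul_eq_mul]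
    have : 2 * Real.pi * -(t * (y * (-l / (2 * Real.pi)))) = t * (l * y) := by
      field_simp
    rw [this]
    push_cast
    ring
  · simp [indicator_of_notMem ht]

/-! ### A Tauberian theorem -/

section Tauberian

variable {B K : ℝ → ℝ} {C : ℝ}

/-- An upper bound for `B y` by an average of `B` over a window to the right of `y`, where `B` is
at least `exp (-2a/l) * B y`. -/
lemma mul_setIntegral_le_integral_comp_sub_mul (hB0 : ∀ u, 0 ≤ B u)
    (hmono : Monotone fun u ↦ Real.exp u * B u) (hK0 : ∀ v, 0 ≤ K v) (hK : Integrable K)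
    {a l : ℝ} (hl : 0 < l) {y : ℝ}
    (hint : Integrable fun v ↦ B (y + a / l - v / l) * K v) :
    Real.exp (-(2 * a / l)) * B y * ∫ v in Icc (-a) a, K v ≤
      ∫ v, B (y + a / l - v / l) * K v := by
  rw [← integral_const_mul]
  refine le_trans (setIntegral_mono_on (hK.integrableOn.const_mul _) hint.integrableOn
    measurableSet_Icc fun v hv ↦ ?_) (setIntegral_le_integral hint
    (ae_of_all _ fun v ↦ mul_nonneg (hB0 _) (hK0 _)))
  refine mul_le_mul_of_nonneg_right ?_ (hK0 v)
  have hle : v / l ≤ a / l := by gcongr; exact hv.2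
  have hle' : -(a / l) ≤ v / l := by rw [← neg_div]; gcongr; exact hv.1
  have h := hmono (show y ≤ y + a / l - v / l by linarith)
  dsimp only at h
  calc Real.exp (-(2 * a / l)) * B y
      = Real.exp (-(2 * a / l) - y) * (Real.exp y * B y) := by
        rw [← mul_assoc, ← Real.exp_add, sub_add_cancel]
    _ ≤ Real.exp (-(2 * a / l) - y) *
        (Real.exp (y + a / l - v / l) * B (y + a / l - v / l)) := by gcongr
    _ = Real.exp (-(a / l) - v / l) * B (y + a / l - v / l) := by
        rw [← mul_assoc, ← Real.exp_add]
        ring_nf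
    _ ≤ B (y + a / l - v / l) := by
        refine mul_le_of_le_one_left (hB0 _) (Real.exp_le_one_iff.mpr ?_)
        linarith

/-- A lower bound for `B y` by an average of `B` centred to the left of `y`: on the window `B` is
at most `exp (2a/l) * B y`, and off the window the kernel has small mass. -/
lemma integral_comp_sub_mul_le (hB0 : ∀ u, 0 ≤ B u) (hBC : ∀ u, B u ≤ C)
    (hmono : Monotone fun u ↦ Real.exp u * B u) (hK0 : ∀ v, 0 ≤ K v) (hK : Integrable K)
    {a l : ℝ} (hl : 0 < l) {y : ℝ}
    (hint : Integrable fun v ↦ B (y - a / l - v / l) * K v) :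
    ∫ v, B (y - a / l - v / l) * K v ≤
      Real.exp (2 * a / l) * B y * (∫ v, K v) + C * ((∫ v, K v) - ∫ v in Icc (-a) a, K v) := by
  have hcompl := integral_add_compl (measurableSet_Icc (a := -a) (b := a)) hK
  rw [← integral_add_compl (measurableSet_Icc (a := -a) (b := a)) hint]
  refine add_le_add ?_ ?_
  · calc ∫ v in Icc (-a) a, B (y - a / l - v / l) * K v
        ≤ ∫ v in Icc (-a) a, Real.exp (2 * a / l) * B y * K v := by
          refine setIntegral_mono_on hint.integrableOn (hK.integrableOn.const_mul _)
            measurableSet_Icc fun v hv ↦ mul_le_mul_of_nonneg_right ?_ (hK0 v)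
          have hle : v / l ≤ a / l := by gcongr; exact hv.2
          have hle' : -(a / l) ≤ v / l := by rw [← neg_div]; gcongr; exact hv.1
          have h := hmono (show y - a / l - v / l ≤ y by linarith)
          dsimp only at h
          calc B (y - a / l - v / l)
              = Real.exp (-(y - a / l - v / l)) *
                (Real.exp (y - a / l - v / l) * B (y - a / l - v / l)) := by
                rw [← mul_assoc, ← Real.exp_add, neg_add_cancel, Real.exp_zero, one_mul]
            _ ≤ Real.exp (-(y - a / l - v / l)) * (Real.exp y * B y) := by gcongr
            _ = Real.exp (a / l + v / l) * B y := by
                rw [← mul_assoc, ← Real.exp_add]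
                ring_nf
            _ ≤ Real.exp (2 * a / l) * B y := by
                refine mul_le_mul_of_nonneg_right (Real.exp_le_exp.mpr ?_) (hB0 y)
                rw [two_mul, add_div]
                linarith
      _ = Real.exp (2 * a / l) * B y * ∫ v in Icc (-a) a, K v := integral_const_mul _ _
      _ ≤ Real.exp (2 * a / l) * B y * ∫ v, K v :=
          mul_le_mul_of_nonneg_left (setIntegral_le_integral hK (ae_of_all _ hK0))
            (mul_nonneg (Real.exp_pos _).le (hB0 y))
  · rw [← hcompl, add_sub_cancel_left, ← integral_const_mul]
    exact setIntegral_mono hint.integrableOn (hK.integrableOn.const_mul _)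
      fun v ↦ mul_le_mul_of_nonneg_right (hBC _) (hK0 v)

/-- A Tauberian theorem: if `B` is bounded and `exp u * B u` is increasing, so that `B` cannot drop
quickly, then convergence of the averages of `B` against all rescalings of one kernel forces
convergence of `B` itself. -/
theorem tendsto_one_of_tendsto_integral_comp_sub_mul (hBm : Measurable B) (hB0 : ∀ u, 0 ≤ B u)
    (hBC : ∀ u, B u ≤ C) (hmono : Monotone fun u ↦ Real.exp u * B u)
    (hK0 : ∀ v, 0 ≤ K v) (hK : Integrable K) (hKpos : 0 < ∫ v, K v)
    (hconv : ∀ l > 0, Tendsto (fun y ↦ ∫ v, B (y - v / l) * K v) atTop (𝓝 (∫ v, K v))) :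
    Tendsto B atTop (𝓝 1) := by
  have hint : ∀ l y : ℝ, Integrable fun v ↦ B (y - v / l) * K v := fun l y ↦
    hK.bdd_mul (c := C) (Measurable.aestronglyMeasurable (by fun_prop))
      (ae_of_all _ fun v ↦ by rw [Real.norm_of_nonneg (hB0 _)]; exact hBC _)
  have hwin : Tendsto (fun a : ℝ ↦ ∫ v in Icc (-a) a, K v) atTop (𝓝 (∫ v, K v)) :=
    (aecover_Icc tendsto_neg_atTop_atBot tendsto_id).integral_tendsto_of_countably_generated hK
  -- The kernel is cut off at `|v| ≤ a` and rescaled by `l = a ^ 2`: as `a → ∞` the window catches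
  -- all of the mass of the kernel, while its width `2 * a / l` in the variable of `B` shrinks to `0`.
  have hexp : Tendsto (fun a : ℝ ↦ 2 * a / a ^ 2) atTop (𝓝 0) := by
    have : Tendsto (fun a : ℝ ↦ 2 * a⁻¹) atTop (𝓝 0) := by
      simpa using tendsto_inv_atTop_zero.const_mul (2 : ℝ)
    refine this.congr' ?_
    filter_upwards [eventually_gt_atTop 0] with a ha
    field_simp
  refine tendsto_order.mpr ⟨fun b hb ↦ ?_, fun b hb ↦ ?_⟩
  · have hlim : Tendsto (fun a : ℝ ↦ Real.exp (2 * a / a ^ 2) * b * (∫ v, K v) +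
        C * ((∫ v, K v) - ∫ v in Icc (-a) a, K v)) atTop (𝓝 (b * ∫ v, K v)) := by
      have := (((Real.continuous_exp.tendsto 0).comp hexp).mul_const b).mul_const (∫ v, K v)
        |>.add ((hwin.const_sub (∫ v, K v)).const_mul C)
      simpa using this
    obtain ⟨a, ha, ha0⟩ := ((hlim.eventually_lt_const
      (mul_lt_of_lt_one_left hKpos hb)).and (eventually_gt_atTop 0)).exists
    have hl : 0 < a ^ 2 := by positivity
    have hshift := (hconv _ hl).comp (tendsto_atTop_add_const_right atTop (-(a / a ^ 2)) tendsto_id)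
    filter_upwards [hshift.eventually_const_lt ha] with y hy
    have h := hy.trans_le (integral_comp_sub_mul_le hB0 hBC hmono hK0 hK hl
      (hint (a ^ 2) (y - a / a ^ 2)))
    rw [add_lt_add_iff_right, mul_lt_mul_iff_left₀ hKpos,
      mul_lt_mul_iff_right₀ (Real.exp_pos _)] at h
    exact h
  · have hlim : Tendsto (fun a : ℝ ↦ Real.exp (-(2 * a / a ^ 2)) * b * ∫ v in Icc (-a) a, K v)
        atTop (𝓝 (b * ∫ v, K v)) := by
      have := (((Real.continuous_exp.tendsto _).comp hexp.neg).mul_const b).mul hwin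
      simpa using this
    obtain ⟨a, ⟨ha, haw⟩, ha0⟩ := (((hlim.eventually_const_lt
      (lt_mul_of_one_lt_left hKpos hb)).and (hwin.eventually_const_lt hKpos)).and
      (eventually_gt_atTop 0)).exists
    have hl : 0 < a ^ 2 := by positivity
    have hshift := (hconv _ hl).comp (tendsto_atTop_add_const_right atTop (a / a ^ 2) tendsto_id)
    filter_upwards [hshift.eventually_lt_const ha] with y hy
    have h := (mul_setIntegral_le_integral_comp_sub_mul hB0 hmono hK0 hK hl
      (hint (a ^ 2) (y + a / a ^ 2))).trans_lt hy
    rw [mul_lt_mul_iff_left₀ haw, mul_lt_mul_iff_right₀ (Real.exp_pos _)] at h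
    exact h

end Tauberian

/-- The Wiener-Ikehara theorem in logarithmic coordinates, for a bounded `B` supported on the
positive half-line: if the Laplace transform of `B - 1` is continuous up to the imaginary axis,
then `B` tends to `1`. -/
theorem tendsto_one_of_continuousOn_laplace {B : ℝ → ℝ} {C : ℝ} (hBm : Measurable B)
    (hB0 : ∀ u, 0 ≤ B u) (hBC : ∀ u, B u ≤ C) (hmono : Monotone fun u ↦ Real.exp u * B u)
    (hneg : ∀ u ≤ 0, B u = 0)
    {H : ℂ → ℂ} (hH : ContinuousOn H {s | 0 ≤ s.re})
    (hBH : ∀ s : ℂ, 0 < s.re →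
      ∫ u in Ioi (0 : ℝ), ((B u - 1 : ℝ) : ℂ) * Complex.exp (-s * u) = H s) :
    Tendsto B atTop (𝓝 1) := by
  refine tendsto_one_of_tendsto_integral_comp_sub_mul hBm hB0 hBC hmono fejerKernel_nonneg
    integrable_fejerKernel integral_fejerKernel_pos fun l hl ↦ ?_
  have hmain := (tendsto_integral_mul_fejerKernel (β := fun u ↦ B u - 1) (C := C + 1)
    (hBm.sub_const 1) (fun u ↦ by rw [abs_le]; constructor <;> linarith [hB0 u, hBC u])
    hH hBH hl).const_mul l
  have hvar : ∀ (f : ℝ → ℝ) (y : ℝ), ∫ v, f (y - v / l) * fejerKernel v =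
      l * ∫ u, f u * fejerKernel (l * (y - u)) := by
    intro f y
    have h1 := integral_sub_left_eq_self
      (fun w ↦ f (y - (l * w) / l) * fejerKernel (l * w)) volume y
    rw [Measure.integral_comp_mul_left (fun v ↦ f (y - v / l) * fejerKernel v),
      abs_of_pos (inv_pos.mpr hl), smul_eq_mul] at h1
    rw [eq_inv_mul_iff_mul_eq₀ hl.ne'] at h1
    rw [← h1]
    simp only [mul_div_cancel_left₀ _ hl.ne', sub_sub_cancel]
  -- the part of the kernel that is lost by integrating over `u > 0` only is negligible
  have hone : Tendsto (fun y ↦ ∫ v, (Ioi 0).indicator (fun _ ↦ (1 : ℝ)) (y - v / l) *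
      fejerKernel v) atTop (𝓝 (∫ v, fejerKernel v)) := by
    refine tendsto_integral_filter_of_dominated_convergence fejerKernel
      (Eventually.of_forall fun y ↦ ?_) (Eventually.of_forall fun y ↦ ae_of_all _ fun v ↦ ?_)
      integrable_fejerKernel (ae_of_all _ fun v ↦ ?_)
    · have h1 : Measurable ((Ioi (0 : ℝ)).indicator fun _ ↦ (1 : ℝ)) :=
        measurable_const.indicator measurableSet_Ioi
      have h2 := continuous_fejerKernel.measurable
      exact Measurable.aestronglyMeasurable (by fun_prop)
    · rw [norm_mul, Real.norm_of_nonneg (fejerKernel_nonneg v)]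
      refine mul_le_of_le_one_left (fejerKernel_nonneg v) ?_
      exact (norm_indicator_le_norm_self _ _).trans (by simp)
    · refine tendsto_const_nhds.congr' ?_
      filter_upwards [eventually_gt_atTop (v / l)] with y hy
      rw [indicator_of_mem (by simpa using hy), one_mul]
  have hsum := hmain.add hone
  rw [mul_zero, zero_add] at hsum
  refine hsum.congr fun y ↦ ?_
  have hKint : Integrable fun u ↦ fejerKernel (l * (y - u)) :=
    (integrable_fejerKernel.comp_mul_left' hl.ne').comp_sub_left y
  have hBint : Integrable fun u ↦ B u * fejerKernel (l * (y - u)) :=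
    hKint.bdd_mul (c := C) hBm.aestronglyMeasurable
      (ae_of_all _ fun u ↦ by rw [Real.norm_of_nonneg (hB0 _)]; exact hBC _)
  rw [hvar, hvar, ← mul_add]
  congr 1
  have hB : ∫ u, B u * fejerKernel (l * (y - u)) =
      ∫ u in Ioi 0, B u * fejerKernel (l * (y - u)) := by
    refine (setIntegral_eq_integral_of_forall_compl_eq_zero fun u hu ↦ ?_).symm
    rw [hneg u (not_lt.mp hu), zero_mul]
  have h1 : ∫ u, (Ioi 0).indicator (fun _ ↦ (1 : ℝ)) u * fejerKernel (l * (y - u)) =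
      ∫ u in Ioi 0, fejerKernel (l * (y - u)) := by
    rw [← integral_indicator measurableSet_Ioi]
    refine integral_congr_ae (ae_of_all _ fun u ↦ ?_)
    by_cases hu : u ∈ Ioi (0 : ℝ) <;> simp [hu]
  rw [hB, h1, ← integral_add _ hKint.integrableOn]
  · simp only [sub_mul, one_mul, sub_add_cancel]
  · simp only [sub_mul, one_mul]
    exact (hBint.sub hKint).integrableOn

/-! ### The Chebyshev function and the von Mangoldt series -/

open ArithmeticFunction in
/-- The Dirichlet series of `Λ` is continuous on `Re s ≥ 1` up to its simple pole at `1`. Mathlib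
proves this, from the non-vanishing of `ζ` on `Re s = 1`, for all residue classes; here the modulus
is `1`. -/
lemma exists_continuousOn_LSeries_vonMangoldt_eq : ∃ G : ℂ → ℂ, ContinuousOn G {s | 1 ≤ s.re} ∧
    ∀ s : ℂ, 1 < s.re → LSeries (fun n ↦ (vonMangoldt n : ℂ)) s = G s + 1 / (s - 1) := by
  refine ⟨_, vonMangoldt.continuousOn_LFunctionResidueClassAux (q := 1) 1, fun s hs ↦ ?_⟩
  have h := vonMangoldt.eqOn_LFunctionResidueClassAux (q := 1) (a := 1) isUnit_one hs
  have hΛ : vonMangoldt.residueClass (1 : ZMod 1) = fun n ↦ vonMangoldt n := by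
    ext n
    simp [vonMangoldt.residueClass, Subsingleton.elim (n : ZMod 1) 1]
  dsimp only at h
  rw [h, hΛ]
  simp

/-- The ratio `ψ(x) / x` in the logarithmic coordinate `x = exp u`. -/
noncomputable def chebyshevRatio (u : ℝ) : ℝ := Chebyshev.psi (Real.exp u) * Real.exp (-u)

lemma exp_mul_chebyshevRatio (u : ℝ) :
    Real.exp u * chebyshevRatio u = Chebyshev.psi (Real.exp u) := by
  rw [chebyshevRatio, mul_left_comm, ← Real.exp_add, add_neg_cancel, Real.exp_zero, mul_one]

lemma measurable_chebyshevRatio : Measurable chebyshevRatio :=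
  (Chebyshev.psi_mono.measurable.comp Real.measurable_exp).mul (by fun_prop)

lemma chebyshevRatio_nonneg (u : ℝ) : 0 ≤ chebyshevRatio u :=
  mul_nonneg (Chebyshev.psi_nonneg _) (Real.exp_pos _).le

lemma chebyshevRatio_le (u : ℝ) : chebyshevRatio u ≤ Real.log 4 + 4 := by
  rw [chebyshevRatio, Real.exp_neg, ← div_eq_mul_inv, div_le_iff₀ (Real.exp_pos u)]
  exact Chebyshev.psi_le_const_mul_self (Real.exp_pos u).le

lemma chebyshevRatio_of_nonpos {u : ℝ} (hu : u ≤ 0) : chebyshevRatio u = 0 := by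
  rw [chebyshevRatio, Chebyshev.psi_eq_zero_of_le_one (Real.exp_le_one_iff.mpr hu), zero_mul]

lemma monotone_exp_mul_chebyshevRatio : Monotone fun u ↦ Real.exp u * chebyshevRatio u := by
  simp only [exp_mul_chebyshevRatio]
  exact Chebyshev.psi_mono.comp Real.exp_monotone

/-- Partial summation, in logarithmic coordinates. -/
lemma LSeries_vonMangoldt_eq_mul_integral {s : ℂ} (hs : 1 < s.re) :
    LSeries (fun n ↦ (ArithmeticFunction.vonMangoldt n : ℂ)) s =
      s * ∫ u in Ioi (0 : ℝ), (chebyshevRatio u : ℂ) * Complex.exp (-(s - 1) * u) := by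
  have hsum : ∀ x : ℝ, ∑ k ∈ Finset.Icc 1 ⌊x⌋₊, ArithmeticFunction.vonMangoldt k =
      Chebyshev.psi x := fun x ↦ rfl
  have hO : (fun n : ℕ ↦ ∑ k ∈ Finset.Icc 1 n, ArithmeticFunction.vonMangoldt k) =O[atTop]
      fun n ↦ (n : ℝ) ^ (1 : ℝ) := by
    refine Asymptotics.IsBigO.of_bound (Real.log 4 + 4) (Eventually.of_forall fun n ↦ ?_)
    have := hsum n
    rw [Nat.floor_natCast] at this
    rw [this, Real.rpow_one, Real.norm_of_nonneg (Chebyshev.psi_nonneg _),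
      Real.norm_of_nonneg n.cast_nonneg]
    exact Chebyshev.psi_le_const_mul_self n.cast_nonneg
  rw [LSeries_eq_mul_integral_of_nonneg _ zero_le_one hs hO
    fun n ↦ ArithmeticFunction.vonMangoldt_nonneg]
  congr 1
  have h := integral_comp_exp_Ioi (fun x : ℝ ↦
    (∑ k ∈ Finset.Icc 1 ⌊x⌋₊, (ArithmeticFunction.vonMangoldt k : ℂ)) * (x : ℂ) ^ (-(s + 1))) 0
  rw [Real.exp_zero] at h
  rw [← h]
  refine setIntegral_congr_fun measurableSet_Ioi fun u _ ↦ ?_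
  rw [← Complex.ofReal_sum, hsum, chebyshevRatio, Complex.real_smul,
    Complex.cpow_def_of_ne_zero (by exact_mod_cast (Real.exp_pos u).ne'),
    ← Complex.ofReal_log (Real.exp_pos u).le, Real.log_exp]
  push_cast
  rw [mul_left_comm, mul_assoc, ← Complex.exp_add, ← Complex.exp_add]
  congr 2
  ring

lemma integrableOn_chebyshevRatio_mul_exp {s : ℂ} (hs : 0 < s.re) :
    IntegrableOn (fun u ↦ (chebyshevRatio u : ℂ) * Complex.exp (-s * u)) (Ioi 0) := by
  have hm := measurable_chebyshevRatio
  refine Integrable.bdd_mul (c := Real.log 4 + 4)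
    (integrableOn_exp_mul_complex_Ioi (by simpa using hs) 0)
    (Measurable.aestronglyMeasurable (by fun_prop)) (ae_of_all _ fun u ↦ ?_)
  rw [Complex.norm_real, Real.norm_of_nonneg (chebyshevRatio_nonneg u)]
  exact chebyshevRatio_le u

theorem tendsto_chebyshevRatio : Tendsto chebyshevRatio atTop (𝓝 1) := by
  -- With `L(Λ, s) = G(s) + 1 / (s - 1)`, the Laplace transform of `ψ(exp u) * exp (-u) - 1` at `s` is
  -- `(G(s + 1) + 1 / s) / (s + 1) - 1 / s = (G(s + 1) - 1) / (s + 1)`, with no pole left.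
  obtain ⟨G, hG, hLG⟩ := exists_continuousOn_LSeries_vonMangoldt_eq
  refine tendsto_one_of_continuousOn_laplace measurable_chebyshevRatio chebyshevRatio_nonneg
    chebyshevRatio_le monotone_exp_mul_chebyshevRatio (fun u ↦ chebyshevRatio_of_nonpos)
    (H := fun s ↦ (G (s + 1) - 1) / (s + 1)) ?_ fun s hs ↦ ?_
  · refine ContinuousOn.div ((hG.comp (by fun_prop) fun s hs ↦ ?_).sub continuousOn_const)
      (by fun_prop) fun s hs h ↦ ?_
    · simpa using hs
    · have : (s + 1).re = 0 := by rw [h, Complex.zero_re]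
      rw [Complex.add_re, Complex.one_re] at this
      have : 0 ≤ s.re := hs
      linarith
  · have hs1 : 1 < (s + 1).re := by simpa using hs
    have hs0 : s ≠ 0 := fun h ↦ by simp [h] at hs
    have hs1' : s + 1 ≠ 0 := fun h ↦ by rw [h, Complex.zero_re] at hs1; linarith
    have hre : (-s).re < 0 := by simpa using hs
    have h := hLG _ hs1
    rw [LSeries_vonMangoldt_eq_mul_integral hs1, add_sub_cancel_right] at h
    simp only [Complex.ofReal_sub, Complex.ofReal_one, sub_mul, one_mul]
    rw [integral_sub (integrableOn_chebyshevRatio_mul_exp hs)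
      (integrableOn_exp_mul_complex_Ioi hre 0), integral_exp_mul_complex_Ioi hre,
      eq_div_iff hs1', sub_mul, mul_comm _ (s + 1), h]
    simp
    field_simp
    ring

theorem tendsto_psi_div : Tendsto (fun x ↦ Chebyshev.psi x / x) atTop (𝓝 1) := by
  refine (tendsto_chebyshevRatio.comp Real.tendsto_log_atTop).congr' ?_
  filter_upwards [eventually_gt_atTop 0] with x hx
  rw [Function.comp_apply, chebyshevRatio, Real.exp_neg, Real.exp_log hx, div_eq_mul_inv]

end

/-! ### Strict summation -/

lemma chebyshevPsi_le_psi (x : ℝ) : chebyshevPsi x ≤ Chebyshev.psi x := by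
  refine Finset.sum_le_sum_of_subset_of_nonneg (fun n hn ↦ ?_)
    fun _ _ _ ↦ ArithmeticFunction.vonMangoldt_nonneg
  rw [mem_Ico_one_ceil_iff] at hn
  rw [Finset.mem_Ioc]
  exact ⟨hn.1, Nat.le_floor hn.2.le⟩

lemma psi_sub_one_le_chebyshevPsi (x : ℝ) : Chebyshev.psi (x - 1) ≤ chebyshevPsi x := by
  refine Finset.sum_le_sum_of_subset_of_nonneg (fun n hn ↦ ?_)
    fun _ _ _ ↦ ArithmeticFunction.vonMangoldt_nonneg
  rw [Finset.mem_Ioc] at hn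
  rw [mem_Ico_one_ceil_iff]
  have := (Nat.le_floor_iff' hn.1.ne').mp hn.2
  exact ⟨hn.1, by linarith⟩

theorem mainTheorem1 :
    Asymptotics.IsEquivalent Filter.atTop chebyshevPsi (fun x : ℝ => x) := by
  have hne : ∀ᶠ x : ℝ in Filter.atTop, x ≠ 0 := Filter.eventually_ne_atTop 0
  rw [Asymptotics.isEquivalent_iff_tendsto_one hne]
  have hshift : Filter.Tendsto (fun x : ℝ ↦ Chebyshev.psi (x - 1) / x) Filter.atTop (nhds 1) := by
    have h1 := tendsto_psi_div.comp (Filter.tendsto_atTop_add_const_right Filter.atTop (-1 : ℝ)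
      Filter.tendsto_id)
    have h2 : Filter.Tendsto (fun x : ℝ ↦ 1 - x⁻¹) Filter.atTop (nhds 1) := by
      simpa using tendsto_inv_atTop_zero.const_sub (1 : ℝ)
    have h3 := h1.mul h2
    rw [one_mul] at h3
    refine h3.congr' ?_
    filter_upwards [Filter.eventually_gt_atTop 1] with x hx
    have hx1 : x - 1 ≠ 0 := by linarith
    have hx0 : x ≠ 0 := by linarith
    simp only [Function.comp_apply, id_eq, ← sub_eq_add_neg]
    field_simp
  -- the strict sum `chebyshevPsi x` lies between `ψ (x - 1)` and `ψ x`
  refine tendsto_of_tendsto_of_tendsto_of_le_of_le' hshift tendsto_psi_div ?_ ?_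
  · filter_upwards [Filter.eventually_gt_atTop 0] with x hx
    exact div_le_div_of_nonneg_right (psi_sub_one_le_chebyshevPsi x) hx.le
  · filter_upwards [Filter.eventually_gt_atTop 0] with x hx
    exact div_le_div_of_nonneg_right (chebyshevPsi_le_psi x) hx.le
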